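/- Let $D\subseteq\mathbb R^m$ be open, let $f:D\to\mathbb R^m$ be (real) analytic, let $0<h^*<r^*$, and let $y:[0,h^*]\to D$ solve $\dot y=f(y)$, $y(0)=y_0$. Let $|\cdot|$ be any norm (or seminorm) on $\mathbb R^m$. Put $\omega(c)=\frac{1}{\pi\sqrt{c(1-c)}}$ for $c\in(0,1)$, $P_0=1$ and $P_j(c)=\sqrt2\,T_j(2c-1)$ for $j\ge1$, where $T_j$ is the $j$-th Chebyshev polynomial of the first kind. For $h\in(0,h^*]$ and an integer $s\ge1$, an $(h,s)$-approximation is a polynomial function $\sigma$ (of degree at most $s$) with $\sigma([0,h])\subseteq D$ and $$\sigma(ch)=y_0+h\sum_{j=0}^{s-1}\int_0^cP_j(x)\,dx\;\gamma_j(\sigma),\quad c\in[0,1],\qquad \gamma_j(\sigma)=\int_0^1\omega(c)P_j(c)f(\sigma(ch))\,dc .$$ For $h\in(0,h^*]$ put $\rho=\rho(h)=r^*/h$; thus $\rho\sim h^{-1}$, and $\rho>1$. Call a function on a real interval $[0,T]$ analytic in the closed ball $\mathcal B_{r^*}(0)=\{z\in\mathbb C:|z|\le r^*\}$, where $T<r^*$,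 if it is the restriction of a $\mathbb C^m$-valued function that is analytic at every point of $\mathcal B_{r^*}(0)$. (i) Suppose that $t\mapsto f(y(t))$, $t\in[0,h^*]$, is analytic in $\mathcal B_{r^*}(0)$. Then for every compact $K\subset D$ there is a constant $M=M(h^*)>0$, which does not depend on $h$, $s$ or $\sigma$ (but may depend on $K$ and on the data $f,y,r^*,|\cdot|$), such that for all $h\in(0,h^*]$, all $s\ge1$ and all $(h,s)$-approximations $\sigma$ with $\sigma([0,h])\subseteq K$, $$\max_{c\in[0,1]}|\sigma(ch)-y(ch)|\le h\,M\,\rho^{-s}.$$ (ii) For every $B$ there is a constant $M=M(h^*)>0$, which does not depend on $h$, $s$ or $\sigma$ (but may depend on $B$ and on the data $f,y,r^*,|\cdot|$), such that the same bound holds for all $h\in(0,h^*]$, all $s\ge1$ and all $(h,s)$-approximations $\sigma$ for which $t\mapsto f(\sigma(t))$, $t\in[0,h]$, is analytic in $\mathcal B_{r^*}(0)$ with an extension bounded there by $B$ (in the maximum norm of $\mathbb C^m$). -/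

import Mathlib

noncomputable section

namespace ChebyshevSpectral

/-- The Chebyshev weight `ω(c) = 1 / (π √(c (1 - c)))` on `(0, 1)`. -/
def weight (c : ℝ) : ℝ := 1 / (Real.pi * Real.sqrt (c * (1 - c)))

/-- The shifted and scaled Chebyshev polynomials of the first kind, orthonormal on `[0, 1]` with
respect to `weight`: `P₀ = 1` and `P_j(c) = √2 T_j(2c - 1)` for `j ≥ 1`. -/
def basis (j : ℕ) (c : ℝ) : ℝ :=
  if j = 0 then 1 else Real.sqrt 2 * (Polynomial.Chebyshev.T ℝ (j : ℤ)).eval (2 * c - 1)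

/-- The weighted Fourier coefficient `γ_j(u) = ∫₀¹ ω(c) P_j(c) f(u(ch)) dc`. -/
def fourierCoeff {m : ℕ} (f : (Fin m → ℝ) → (Fin m → ℝ)) (h : ℝ) (u : ℝ → Fin m → ℝ) (j : ℕ) :
    Fin m → ℝ :=
  ∫ c in (0 : ℝ)..1, (weight c * basis j c) • f (u (c * h))

/-- `y` solves `y' = f(y)`, `y(0) = y₀` on `[0, T]`, with values in the domain `D` of `f`
(the derivatives at the end points are one-sided). -/
def IsSolution {m : ℕ} (f : (Fin m → ℝ) → (Fin m → ℝ)) (D : Set (Fin m → ℝ)) (y₀ : Fin m → ℝ)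
    (T : ℝ) (y : ℝ → Fin m → ℝ) : Prop :=
  y 0 = y₀ ∧ ∀ t ∈ Set.Icc 0 T, y t ∈ D ∧ HasDerivWithinAt y (f (y t)) (Set.Icc 0 T) t

/-- `σ` is, on `[0, h]`, a polynomial approximation of degree at most `s` with timestep `h`: it
takes values in the domain `D` of `f` and satisfies
`σ(ch) = y₀ + h ∑_{j<s} (∫₀ᶜ P_j(x) dx) γ_j(σ)` for all `c ∈ [0, 1]`. -/
def IsApprox {m : ℕ} (f : (Fin m → ℝ) → (Fin m → ℝ)) (D : Set (Fin m → ℝ)) (y₀ : Fin m → ℝ)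
    (h : ℝ) (s : ℕ) (σ : ℝ → Fin m → ℝ) : Prop :=
  ∀ c ∈ Set.Icc (0 : ℝ) 1, σ (c * h) ∈ D ∧
    σ (c * h) = y₀ + h • ∑ j ∈ Finset.range s,
      (∫ x in (0 : ℝ)..c, basis j x) • fourierCoeff f h σ j

/-- `g` is analytic in the closed complex ball of radius `r` centred at `0` (that is, at each of
its points) and extends the real vector function `u` on `[0, T]`. -/
def IsAnalyticExtension {m : ℕ} (u : ℝ → Fin m → ℝ) (T r : ℝ) (g : ℂ → Fin m → ℂ) : Prop :=
  AnalyticOnNhd ℂ g (Metric.closedBall 0 r) ∧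
    ∀ t ∈ Set.Icc 0 T, ∀ i, g (t : ℂ) i = ((u t i : ℝ) : ℂ)

end ChebyshevSpectral

end

namespace ChebyshevSpectral

open MeasureTheory Polynomial Set intervalIntegral Filter Topology

/-! Write `E_s(g)(c)` for the integral over `[0, c]` of the truncated Chebyshev expansion of `g`
minus `g`. The scheme is the integral form of the equation perturbed by `h • E_s`, so the error
satisfies `e(c) = h E_s(f ∘ σ)(c) + h ∫₀ᶜ (f ∘ σ - f ∘ y)`. Gronwall then reduces everything to
bounding `E_s`.

The weight has total mass one and the `P_j` form a Hilbert basis of the weighted `L²` space.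
Integration over `[0, c]` is the inner product with a bounded kernel `k_c`, so `|E_s(g)(c)|` is at
most the distance from `k_c` to the span of `P_0, …, P_{s-1}` times the sup of `|g|`
(`abs_truncError_le`). This distance is at most `π`, and tends to `0` uniformly in `c` by Parseval
and Dini. Also `E_s` kills polynomials of degree below `s`, so Taylor polynomials give `E_s(g) =
O((h / r) ^ s)` for analytic data.

If `f ∘ σ` is analytic this bounds the inhomogeneity directly, and a continuation argument keeps `σ`
near `y`, where `f` is Lipschitz. If only `f ∘ y` is analytic, the rest `E_s(f ∘ σ - f ∘ y)` is at
most a multiple of the maximal error; it is absorbed when `s` is large or `h` is small, and in the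
remaining range a crude bound suffices. -/

/-! ### The Chebyshev weight as a probability measure -/

theorem weight_eq (c : ℝ) :
    weight c = 2 / Real.pi * Real.sqrt (1 - (2 * c - 1) ^ 2)⁻¹ := by
  have h : (1 - (2 * c - 1) ^ 2) = 2 ^ 2 * (c * (1 - c)) := by ring
  rw [weight, Real.sqrt_inv, h, Real.sqrt_mul (x := 2 ^ 2) (by norm_num),
    Real.sqrt_sq (by norm_num)]
  field_simp

theorem weight_nonneg (c : ℝ) : 0 ≤ weight c := by unfold weight; positivity

theorem measurable_weight : Measurable weight := by unfold weight; fun_prop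

theorem intervalIntegrable_weight : IntervalIntegrable weight volume 0 1 := by
  have h := (Chebyshev.intervalIntegrable_sqrt_one_sub_sq_inv.comp_sub_right 1).comp_mul_left
    (c := 2)
  have h2 := h.const_mul (2 / Real.pi)
  norm_num at h2
  refine h2.congr ?_
  intro x _
  simp [weight_eq]

theorem integral_weight_mul_comp (u : ℝ → ℝ) :
    ∫ c in (0 : ℝ)..1, weight c * u (2 * c - 1) =
      Real.pi⁻¹ * ∫ x, u x ∂Chebyshev.measureT := by
  rw [Chebyshev.integral_measureT]
  have h := intervalIntegral.mul_integral_comp_mul_sub (a := 0) (b := 1)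
    (f := fun x => u x * Real.sqrt (1 - x ^ 2)⁻¹) 2 1
  norm_num at h
  norm_num
  rw [← h, ← mul_assoc, ← intervalIntegral.integral_const_mul]
  congr 1
  ext c
  rw [weight_eq, Real.sqrt_inv]
  ring

/-- The measure `ω(c) dc` on `(0, 1]`. -/
noncomputable def weightMeasure : Measure ℝ :=
  (volume.restrict (Ioc 0 1)).withDensity fun c => ENNReal.ofReal (weight c)

theorem integral_weightMeasure (u : ℝ → ℝ) :
    ∫ c, u c ∂weightMeasure = ∫ c in (0 : ℝ)..1, weight c * u c := by
  rw [weightMeasure, integral_withDensity_eq_integral_toReal_smul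
    measurable_weight.ennreal_ofReal (by simp), intervalIntegral.integral_of_le zero_le_one]
  simp [ENNReal.toReal_ofReal (weight_nonneg _)]

instance : IsFiniteMeasure weightMeasure := by
  refine isFiniteMeasure_withDensity_ofReal ?_
  have := intervalIntegrable_weight
  rw [intervalIntegrable_iff_integrableOn_Ioc_of_le zero_le_one] at this
  exact this.2

theorem ae_mem_Icc_weightMeasure : ∀ᵐ c ∂weightMeasure, c ∈ Icc (0 : ℝ) 1 := by
  refine (withDensity_absolutelyContinuous _ _).ae_le ?_
  filter_upwards [ae_restrict_mem measurableSet_Ioc] with c hc using Ioc_subset_Icc_self hc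

theorem memLp_of_bounded_on {u : ℝ → ℝ} (hu : Measurable u) {A : ℝ}
    (hA : ∀ x ∈ Icc (0 : ℝ) 1, |u x| ≤ A) : MemLp u 2 weightMeasure := by
  refine MemLp.of_bound hu.aestronglyMeasurable A ?_
  filter_upwards [ae_mem_Icc_weightMeasure] with c hc using hA c hc

theorem memLp_of_continuous {u : ℝ → ℝ} (hu : Continuous u) : MemLp u 2 weightMeasure := by
  obtain ⟨A, hA⟩ := isCompact_Icc.exists_bound_of_continuousOn (hu.continuousOn (s := Icc (0:ℝ) 1))
  exact memLp_of_bounded_on hu.measurable hA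

theorem weightMeasure_real_univ : weightMeasure.real univ = 1 := by
  have h := integral_weightMeasure (fun _ => 1)
  have h2 := integral_weight_mul_comp (fun _ => 1)
  have h3 := Chebyshev.integral_eval_T_real_measureT_zero
  simp only [Chebyshev.T_zero, eval_one] at h3
  rw [h2, h3, inv_mul_cancel₀ Real.pi_ne_zero] at h
  simpa using h

/-- Total mass one makes the sup norm dominate the weighted `L²` norm with constant exactly one. -/
theorem norm_toLp_le {u : ℝ → ℝ} (hu : MemLp u 2 weightMeasure) {A : ℝ} (hA0 : 0 ≤ A)
    (hA : ∀ x ∈ Icc (0 : ℝ) 1, |u x| ≤ A) : ‖hu.toLp u‖ ≤ A := by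
  have := Lp.norm_le_of_ae_bound (f := hu.toLp u) hA0 (by
    filter_upwards [hu.coeFn_toLp, ae_mem_Icc_weightMeasure] with c hc hc'
    rw [hc]; exact hA c hc')
  refine this.trans (le_of_eq ?_)
  have h1 : measureUnivNNReal weightMeasure = 1 := by
    have h : (weightMeasure univ).toReal = 1 := weightMeasure_real_univ
    rw [measureUnivNNReal, ← NNReal.coe_inj]
    exact h
  simp [h1]

theorem inner_toLp {u v : ℝ → ℝ} (hu : MemLp u 2 weightMeasure) (hv : MemLp v 2 weightMeasure) :
    inner ℝ (hu.toLp u) (hv.toLp v) = ∫ c in (0 : ℝ)..1, weight c * (u c * v c) := by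
  rw [L2.inner_def, ← integral_weightMeasure]
  refine integral_congr_ae ?_
  filter_upwards [hu.coeFn_toLp, hv.coeFn_toLp] with c h1 h2
  rw [h1, h2]
  simp [mul_comm]

/-! ### The Chebyshev polynomials as a complete orthonormal system -/

/-- The polynomials `P_j`. -/
noncomputable def basisPoly (j : ℕ) : ℝ[X] :=
  C (if j = 0 then 1 else Real.sqrt 2) * (Chebyshev.T ℝ (j : ℤ)).comp (C 2 * X - C 1)

theorem eval_basisPoly (j : ℕ) (c : ℝ) : (basisPoly j).eval c = basis j c := by
  by_cases h : j = 0 <;> simp [basisPoly, basis, h]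

theorem degree_basisPoly (j : ℕ) : (basisPoly j).degree = j := by
  have h1 : (C (2:ℝ) * X - C 1).natDegree = 1 := by
    rw [natDegree_sub_C, natDegree_C_mul_X _ two_ne_zero]
  have h2 : (if j = 0 then 1 else Real.sqrt 2) ≠ 0 := by split_ifs <;> positivity
  have h3 : (basisPoly j).natDegree = j := by
    rw [basisPoly, natDegree_C_mul h2, natDegree_comp, h1, Chebyshev.natDegree_T]
    simp
  by_cases hj : j = 0
  · subst hj; simp [basisPoly]
  · rw [degree_eq_natDegree, h3]
    intro h; rw [h] at h3; simp at h3; omega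

/-- The polynomials `P_j` as a polynomial sequence. -/
noncomputable def basisSequence : Polynomial.Sequence ℝ where
  elems' := basisPoly
  degree_eq' := degree_basisPoly

theorem isUnit_leadingCoeff_basisSequence (j : ℕ) : IsUnit (basisSequence j).leadingCoeff :=
  (leadingCoeff_ne_zero.2 (basisSequence.ne_zero j)).isUnit

theorem continuous_basis (j : ℕ) : Continuous (basis j) := by
  have : basis j = fun c => (basisPoly j).eval c := funext fun c => (eval_basisPoly j c).symm
  rw [this]; exact (basisPoly j).continuous

theorem integral_weight_basis_mul_basis (i j : ℕ) :
    ∫ c in (0 : ℝ)..1, weight c * (basis i c * basis j c) = if i = j then 1 else 0 := by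
  let n : ℕ → ℝ := fun j => if j = 0 then 1 else Real.sqrt 2
  have h1 : ∀ j c, basis j c = n j * (Chebyshev.T ℝ (j : ℤ)).eval (2 * c - 1) := by
    intro j c
    by_cases h : j = 0 <;> simp [n, basis, h]
  have h2 : ∀ c, weight c * (basis i c * basis j c) = (n i * n j) * (weight c *
      ((Chebyshev.T ℝ (i : ℤ)).eval (2 * c - 1) * (Chebyshev.T ℝ (j : ℤ)).eval (2 * c - 1))) := by
    intro c; rw [h1, h1]; ring
  simp_rw [h2]
  rw [intervalIntegral.integral_const_mul, integral_weight_mul_comp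
    (fun x => (Chebyshev.T ℝ (i : ℤ)).eval x * (Chebyshev.T ℝ (j : ℤ)).eval x)]
  by_cases hij : i = j
  · subst hij
    by_cases hi : i = 0
    · subst hi
      have := Chebyshev.integral_eval_T_real_mul_self_measureT_zero
      simp only [Nat.cast_zero]
      rw [this]
      simp [n, Real.pi_ne_zero]
    · rw [Chebyshev.integral_T_real_mul_self_measureT_of_ne_zero hi]
      simp only [n, hi, if_false, if_true, Real.mul_self_sqrt zero_le_two]
      field_simp
  · rw [Chebyshev.integral_eval_T_real_mul_eval_T_real_measureT_of_ne hij]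
    simp [hij]

theorem memLp_basis (j : ℕ) : MemLp (basis j) 2 weightMeasure :=
  memLp_of_continuous (continuous_basis j)

/-- The class of `P_j` in the weighted `L²` space. -/
noncomputable def basisLp (j : ℕ) : Lp ℝ 2 weightMeasure := (memLp_basis j).toLp (basis j)

theorem orthonormal_basisLp : Orthonormal ℝ basisLp := by
  rw [orthonormal_iff_ite]
  intro i j
  rw [basisLp, basisLp, inner_toLp, integral_weight_basis_mul_basis]

/-- Since `P_j` has degree exactly `j`, the `P_j` span all polynomials; the linear map to `L²`
carries this over. -/
theorem toLp_eval_mem_span (p : ℝ[X]) (hp : MemLp (fun x => p.eval x) 2 weightMeasure) :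
    hp.toLp _ ∈ Submodule.span ℝ (range basisLp) := by
  let Φ : ℝ[X] →ₗ[ℝ] Lp ℝ 2 weightMeasure :=
    { toFun := fun q => (memLp_of_continuous q.continuous).toLp _
      map_add' := fun q r => by
        rw [← MemLp.toLp_add]; congr 1; ext; simp
      map_smul' := fun a q => by
        rw [← MemLp.toLp_const_smul]; congr 1; ext; simp }
  have h1 : ∀ j, Φ (basisSequence j) = basisLp j := by
    intro j
    simp only [Φ, basisLp]
    exact MemLp.toLp_congr (memLp_of_continuous (basisSequence j).continuous) (memLp_basis j)
      (Eventually.of_forall fun x => eval_basisPoly j x)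
  have h2 : p ∈ Submodule.span ℝ (range basisSequence) := by
    rw [basisSequence.span isUnit_leadingCoeff_basisSequence]; trivial
  have h3 := Submodule.mem_map_of_mem (f := Φ) h2
  rw [Submodule.map_span, ← range_comp] at h3
  rwa [show Φ ∘ basisSequence = basisLp from funext h1] at h3

/-- Continuous bounded functions are dense in `L²`, and Weierstrass approximation on `[0, 1]`
suffices because the measure lives there. -/
theorem top_le_closure_span_basisLp :
    ⊤ ≤ (Submodule.span ℝ (range basisLp)).topologicalClosure := by
  intro x _
  rw [← SetLike.mem_coe, Submodule.topologicalClosure_coe, Metric.mem_closure_iff]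
  intro ε hε
  obtain ⟨g, hg, hgm⟩ := (Lp.memLp x).exists_boundedContinuous_eLpNorm_sub_le (by norm_num)
    (ε := ENNReal.ofReal (ε / 3)) (by simp [hε])
  obtain ⟨p, hp⟩ := exists_polynomial_near_of_continuousOn 0 1 g g.continuous.continuousOn
    (ε / 3) (by positivity)
  have hpm : MemLp (fun x => p.eval x) 2 weightMeasure := memLp_of_continuous p.continuous
  refine ⟨_, toLp_eval_mem_span p hpm, ?_⟩
  have h1 : dist x (hgm.toLp g) ≤ ε / 3 := by
    rw [Lp.dist_def]
    refine ENNReal.toReal_le_of_le_ofReal (by positivity) (le_trans (le_of_eq ?_) hg)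
    refine eLpNorm_congr_ae ?_
    filter_upwards [hgm.coeFn_toLp] with c hc
    simp [hc]
  have h2 : dist (hgm.toLp g) (hpm.toLp _) ≤ ε / 3 := by
    rw [dist_eq_norm, ← MemLp.toLp_sub]
    refine norm_toLp_le _ (by positivity) ?_
    intro c hc
    have := hp c hc
    rw [abs_sub_comm] at this
    exact this.le
  linarith [dist_triangle x (hgm.toLp g) (hpm.toLp (fun x => p.eval x))]

/-! ### The kernel of integration and its distance to the truncated span -/

/-- The function representing `v ↦ ∫₀ᶜ v` with respect to the weighted inner product. -/
noncomputable def primitiveKernel (c : ℝ) : ℝ → ℝ :=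
  indicator (Iic c) fun x => Real.pi * Real.sqrt (x * (1 - x))

theorem integral_weight_primitiveKernel_mul {c : ℝ} (hc : c ∈ Icc (0 : ℝ) 1) (v : ℝ → ℝ) :
    ∫ x in (0 : ℝ)..1, weight x * (primitiveKernel c x * v x) = ∫ x in (0 : ℝ)..c, v x := by
  have h1 : ∫ x in (0 : ℝ)..1, weight x * (primitiveKernel c x * v x) =
      ∫ x in (0 : ℝ)..1, indicator (Iic c) v x := by
    refine intervalIntegral.integral_congr_ae ?_
    -- The kernel is the reciprocal of the weight, but at `x = 1` division by zero makes both vanish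
    -- and the cancellation fails.
    filter_upwards [Measure.ae_ne volume (1 : ℝ)] with x hx1 hx
    rw [uIoc_of_le zero_le_one] at hx
    by_cases hxc : x ∈ Iic c
    · rw [primitiveKernel, indicator_of_mem hxc, indicator_of_mem hxc, weight]
      have : 0 < Real.sqrt (x * (1 - x)) :=
        Real.sqrt_pos.2 (mul_pos hx.1 (sub_pos.2 (lt_of_le_of_ne hx.2 hx1)))
      field_simp
    · rw [primitiveKernel, indicator_of_notMem hxc, indicator_of_notMem hxc]
      simp
  rw [h1, integral_of_le zero_le_one, setIntegral_indicator measurableSet_Iic, Ioc_inter_Iic,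
    min_eq_right hc.2, integral_of_le hc.1]

theorem abs_primitiveKernel_le (c x : ℝ) (hx : x ∈ Icc (0 : ℝ) 1) :
    |primitiveKernel c x| ≤ Real.pi := by
  have h1 : Real.sqrt (x * (1 - x)) ≤ 1 := Real.sqrt_le_one.2 (by nlinarith [hx.1, hx.2])
  rw [primitiveKernel]
  by_cases h : x ∈ Iic c
  · rw [indicator_of_mem h, abs_of_nonneg (by positivity)]
    nlinarith [Real.pi_pos]
  · rw [indicator_of_notMem h, abs_zero]; positivity

theorem memLp_primitiveKernel (c : ℝ) : MemLp (primitiveKernel c) 2 weightMeasure :=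
  memLp_of_bounded_on (Measurable.indicator (by fun_prop) measurableSet_Iic)
    (abs_primitiveKernel_le c)

/-- The class of `primitiveKernel` in the weighted `L²` space. -/
noncomputable def primitiveLp (c : ℝ) : Lp ℝ 2 weightMeasure :=
  (memLp_primitiveKernel c).toLp _

theorem inner_primitiveLp {c : ℝ} (hc : c ∈ Icc (0 : ℝ) 1) {v : ℝ → ℝ}
    (hv : MemLp v 2 weightMeasure) :
    inner ℝ (primitiveLp c) (hv.toLp v) = ∫ x in (0 : ℝ)..c, v x := by
  rw [primitiveLp, inner_toLp, integral_weight_primitiveKernel_mul hc]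

/-- The squared distance of `primitiveKernel c` to the span of `P₀, …, P_{s-1}`. -/
noncomputable def kernelDistSq (s : ℕ) (c : ℝ) : ℝ :=
  (∫ x in (0 : ℝ)..c, Real.pi * Real.sqrt (x * (1 - x))) -
    ∑ j ∈ Finset.range s, (∫ x in (0 : ℝ)..c, basis j x) ^ 2

theorem norm_sq_primitiveLp {c : ℝ} (hc : c ∈ Icc (0 : ℝ) 1) :
    ‖primitiveLp c‖ ^ 2 = ∫ x in (0 : ℝ)..c, Real.pi * Real.sqrt (x * (1 - x)) := by
  rw [← real_inner_self_eq_norm_sq]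
  refine (inner_primitiveLp hc (memLp_primitiveKernel c)).trans ?_
  refine intervalIntegral.integral_congr fun x hx => ?_
  rw [uIcc_of_le hc.1] at hx
  simp [primitiveKernel, hx.2]

/-- Pythagoras: the Fourier coefficients of the kernel are the integrals of `P_j` over `[0, c]`. The
explicit formula in `kernelDistSq` is kept because continuity in `c` and monotonicity in `s` are
visible there. -/
theorem kernelDistSq_eq {c : ℝ} (hc : c ∈ Icc (0 : ℝ) 1) (s : ℕ) :
    kernelDistSq s c = ‖primitiveLp c -
      ∑ j ∈ Finset.range s, (∫ x in (0 : ℝ)..c, basis j x) • basisLp j‖ ^ 2 := by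
  have h1 : ∀ j, inner ℝ (primitiveLp c) (basisLp j) = ∫ x in (0 : ℝ)..c, basis j x :=
    fun j => inner_primitiveLp hc (memLp_basis j)
  rw [norm_sub_sq_real, norm_sq_primitiveLp hc, inner_sum, ← real_inner_self_eq_norm_sq,
    orthonormal_basisLp.inner_sum]
  simp only [inner_smul_right, h1, kernelDistSq, conj_trivial, ← sq]
  ring

theorem tendsto_kernelDistSq {c : ℝ} (hc : c ∈ Icc (0 : ℝ) 1) :
    Tendsto (fun s => kernelDistSq s c) atTop (𝓝 0) := by
  let b := HilbertBasis.mk orthonormal_basisLp top_le_closure_span_basisLp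
  have h := (b.hasSum_inner_mul_inner (primitiveLp c) (primitiveLp c)).tendsto_sum_nat
  rw [real_inner_self_eq_norm_sq, norm_sq_primitiveLp hc] at h
  have h2 : ∀ j, inner ℝ (primitiveLp c) (b j) * inner ℝ (b j) (primitiveLp c) =
      (∫ x in (0 : ℝ)..c, basis j x) ^ 2 := by
    intro j
    rw [real_inner_comm (primitiveLp c) (b j), HilbertBasis.coe_mk, basisLp,
      inner_primitiveLp hc, sq]
  simp only [h2] at h
  simpa [kernelDistSq] using h.const_sub (∫ x in (0 : ℝ)..c, Real.pi * Real.sqrt (x * (1 - x)))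

theorem kernelDistSq_anti (c : ℝ) : Antitone fun s => kernelDistSq s c := by
  refine antitone_nat_of_succ_le fun s => ?_
  simp only [kernelDistSq, Finset.sum_range_succ]
  nlinarith [sq_nonneg (∫ x in (0 : ℝ)..c, basis s x)]

theorem continuous_kernelDistSq (s : ℕ) : Continuous (kernelDistSq s) := by
  refine Continuous.sub ?_ (continuous_finsetSum _ fun j _ => Continuous.pow ?_ 2)
  · exact intervalIntegral.continuous_primitive
      (fun a b => Continuous.intervalIntegrable (by fun_prop) a b) 0
  · exact intervalIntegral.continuous_primitive
      (fun a b => (continuous_basis j).intervalIntegrable a b) 0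

/-- Dini's theorem upgrades the pointwise limit given by Parseval. -/
theorem tendstoUniformlyOn_kernelDistSq :
    TendstoUniformlyOn kernelDistSq (fun _ => 0) atTop (Icc (0 : ℝ) 1) :=
  Antitone.tendstoUniformlyOn_of_forall_tendsto isCompact_Icc
    (fun s => (continuous_kernelDistSq s).continuousOn) (fun c _ => kernelDistSq_anti c)
    continuousOn_const fun _ hc => tendsto_kernelDistSq hc

/-! ### The integrated truncation error -/

/-- The integrated error `∫₀ᶜ (∑_{j<s} γ_j P_j - g)` of the truncated Chebyshev expansion. -/
noncomputable def truncError (s : ℕ) (g : ℝ → ℝ) (c : ℝ) : ℝ :=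
  ∑ j ∈ Finset.range s, (∫ x in (0 : ℝ)..c, basis j x) *
    (∫ x in (0 : ℝ)..1, weight x * basis j x * g x) - ∫ x in (0 : ℝ)..c, g x

/-- By self-adjointness of the projection, the error is minus the inner product of `g` with the part
of the kernel orthogonal to `P_0, …, P_{s-1}`; then Cauchy–Schwarz. -/
theorem abs_truncError_le_of_continuous {g : ℝ → ℝ} (hg : Continuous g) {A : ℝ}
    (hA : ∀ x ∈ Icc (0 : ℝ) 1, |g x| ≤ A) (s : ℕ) {c : ℝ} (hc : c ∈ Icc (0 : ℝ) 1) :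
    |truncError s g c| ≤ Real.sqrt (kernelDistSq s c) * A := by
  have hA0 : 0 ≤ A := (abs_nonneg _).trans (hA 0 (by simp))
  have hgm := memLp_of_continuous hg
  have h1 : truncError s g c = -inner ℝ (primitiveLp c -
      ∑ j ∈ Finset.range s, (∫ x in (0 : ℝ)..c, basis j x) • basisLp j) (hgm.toLp g) := by
    rw [inner_sub_left, inner_primitiveLp hc, sum_inner]
    simp only [inner_smul_left, basisLp, inner_toLp, truncError, conj_trivial, mul_assoc]
    ring
  rw [h1, abs_neg]
  refine (abs_real_inner_le_norm _ _).trans ?_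
  rw [kernelDistSq_eq hc, Real.sqrt_sq (norm_nonneg _)]
  gcongr
  exact norm_toLp_le hgm hA0 hA

theorem truncError_congr {s : ℕ} {g g' : ℝ → ℝ} (h : EqOn g g' (Icc 0 1)) {c : ℝ}
    (hc : c ∈ Icc (0 : ℝ) 1) : truncError s g c = truncError s g' c := by
  unfold truncError
  congr 1
  · refine Finset.sum_congr rfl fun j _ => ?_
    congr 1
    refine intervalIntegral.integral_congr fun x hx => ?_
    rw [uIcc_of_le zero_le_one] at hx
    simp only [h hx]
  · refine intervalIntegral.integral_congr fun x hx => ?_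
    rw [uIcc_of_le hc.1] at hx
    exact h ⟨hx.1, hx.2.trans hc.2⟩

theorem abs_truncError_le {g : ℝ → ℝ} (hg : ContinuousOn g (Icc 0 1)) {A : ℝ}
    (hA : ∀ x ∈ Icc (0 : ℝ) 1, |g x| ≤ A) (s : ℕ) {c : ℝ} (hc : c ∈ Icc (0 : ℝ) 1) :
    |truncError s g c| ≤ Real.sqrt (kernelDistSq s c) * A := by
  have h : EqOn g (IccExtend zero_le_one (domRestrict (Icc (0 : ℝ) 1) g)) (Icc 0 1) := fun x hx => by
    rw [IccExtend_of_mem _ _ hx]; rfl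
  rw [truncError_congr h hc]
  refine abs_truncError_le_of_continuous (continuousOn_iff_continuous_domRestrict.1 hg).Icc_extend'
    (fun x hx => ?_) s hc
  rw [← h hx]; exact hA x hx

theorem sqrt_kernelDistSq_le (s : ℕ) {c : ℝ} (hc : c ∈ Icc (0 : ℝ) 1) :
    Real.sqrt (kernelDistSq s c) ≤ Real.pi := by
  have h0 := kernelDistSq_anti c (Nat.zero_le s)
  have h1 : kernelDistSq 0 c = ‖primitiveLp c‖ ^ 2 := by
    rw [kernelDistSq_eq hc]; simp
  rw [Real.sqrt_le_left Real.pi_pos.le]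
  refine h0.trans ?_
  simp only [h1]
  gcongr
  exact norm_toLp_le _ Real.pi_pos.le (abs_primitiveKernel_le c)

theorem exists_forall_sqrt_kernelDistSq_le {ε : ℝ} (hε : 0 < ε) :
    ∃ s₀ : ℕ, ∀ s ≥ s₀, ∀ c ∈ Icc (0 : ℝ) 1, Real.sqrt (kernelDistSq s c) ≤ ε := by
  have h := (Metric.tendstoUniformlyOn_iff.1 tendstoUniformlyOn_kernelDistSq) (ε ^ 2) (by positivity)
  obtain ⟨s₀, hs₀⟩ := eventually_atTop.1 h
  refine ⟨s₀, fun s hs c hc => ?_⟩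
  have := hs₀ s hs c hc
  rw [Real.sqrt_le_left hε.le]
  rw [dist_comm, Real.dist_0_eq_abs] at this
  exact (le_abs_self _).trans this.le

theorem intervalIntegrable_weight_mul {g : ℝ → ℝ} (hg : ContinuousOn g (Icc 0 1)) :
    IntervalIntegrable (fun x => weight x * g x) volume 0 1 :=
  intervalIntegrable_weight.mul_continuousOn (by rwa [uIcc_of_le zero_le_one])

theorem truncError_add {g g' : ℝ → ℝ} (hg : ContinuousOn g (Icc 0 1))
    (hg' : ContinuousOn g' (Icc 0 1)) (s : ℕ) {c : ℝ} (hc : c ∈ Icc (0 : ℝ) 1) :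
    truncError s (fun x => g x + g' x) c = truncError s g c + truncError s g' c := by
  have hi : ∀ {u : ℝ → ℝ}, ContinuousOn u (Icc 0 1) → IntervalIntegrable u volume 0 c :=
    fun hu => (hu.mono (by rw [uIcc_of_le hc.1]; exact Icc_subset_Icc_right hc.2)).intervalIntegrable
  have hw : ∀ (j : ℕ) {u : ℝ → ℝ}, ContinuousOn u (Icc 0 1) →
      IntervalIntegrable (fun x => weight x * basis j x * u x) volume 0 1 := fun j u hu => by
    simp only [mul_assoc]
    exact intervalIntegrable_weight_mul ((continuous_basis j).continuousOn.mul hu)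
  simp only [truncError, mul_add]
  rw [intervalIntegral.integral_add (hi hg) (hi hg')]
  simp_rw [fun j => intervalIntegral.integral_add (hw j hg) (hw j hg'), mul_add]
  rw [Finset.sum_add_distrib]
  ring

theorem truncError_const_mul (a : ℝ) (g : ℝ → ℝ) (s : ℕ) (c : ℝ) :
    truncError s (fun x => a * g x) c = a * truncError s g c := by
  simp only [truncError, mul_left_comm _ a, intervalIntegral.integral_const_mul, mul_sub,
    Finset.mul_sum]

theorem truncError_sub {g g' : ℝ → ℝ} (hg : ContinuousOn g (Icc 0 1))
    (hg' : ContinuousOn g' (Icc 0 1)) (s : ℕ) {c : ℝ} (hc : c ∈ Icc (0 : ℝ) 1) :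
    truncError s (fun x => g x - g' x) c = truncError s g c - truncError s g' c := by
  have h := truncError_add hg (hg'.const_mul (-1)) s hc
  rw [truncError_const_mul] at h
  simpa [← sub_eq_add_neg] using h

theorem truncError_eval {p : ℝ[X]} {s : ℕ} (hp : p.degree < s) {c : ℝ} (hc : c ∈ Icc (0 : ℝ) 1) :
    truncError s (fun x => p.eval x) c = 0 := by
  have hmem : p ∈ Submodule.span ℝ (basisSequence '' Iio s) := by
    rw [basisSequence.span_degreeLT fun j _ => isUnit_leadingCoeff_basisSequence j]
    exact mem_degreeLT.2 hp
  clear hp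
  induction hmem using Submodule.span_induction with
  | mem x hx =>
    obtain ⟨k, hk, rfl⟩ := hx
    have h1 : ∀ x, (basisSequence k).eval x = basis k x := eval_basisPoly k
    simp only [h1, truncError, mul_assoc, integral_weight_basis_mul_basis]
    simp [mem_Iio.1 hk]
  | zero => simp [truncError]
  | add p q _ _ hp hq =>
    simp only [eval_add]
    rw [truncError_add p.continuous.continuousOn q.continuous.continuousOn s hc, hp, hq, add_zero]
  | smul a p _ hp =>
    simp only [eval_smul, smul_eq_mul]
    rw [truncError_const_mul, hp, mul_zero]

/-- The operator kills `p`, so only `g - p` contributes, and its norm is at most `π` for every `s`.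
-/
theorem abs_truncError_le_of_near {g : ℝ → ℝ} (hg : ContinuousOn g (Icc 0 1)) {s : ℕ} {p : ℝ[X]}
    (hp : p.degree < s) {A : ℝ} (hA : ∀ x ∈ Icc (0 : ℝ) 1, |g x - p.eval x| ≤ A) {c : ℝ}
    (hc : c ∈ Icc (0 : ℝ) 1) : |truncError s g c| ≤ Real.pi * A := by
  have h1 := truncError_sub hg p.continuous.continuousOn s hc
  rw [truncError_eval hp hc, sub_zero] at h1
  rw [← h1]
  have hA0 : 0 ≤ A := (abs_nonneg _).trans (hA 0 (by simp))
  refine (abs_truncError_le (hg.sub p.continuous.continuousOn) hA s hc).trans ?_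
  gcongr
  exact sqrt_kernelDistSq_le s hc

/-- The truncation error of a vector valued function. -/
noncomputable def vecTruncError {m : ℕ} (s : ℕ) (F : ℝ → Fin m → ℝ) (c : ℝ) : Fin m → ℝ :=
  fun i => truncError s (fun x => F x i) c

/-! ### Taylor approximation, Lipschitz and Gronwall estimates -/

/-- A function analytic in a closed disc of radius `r` is approximated on `[0, h]`, `h < r`, by a
polynomial of degree less than `s` up to a multiple of `(h / r) ^ s`. -/
theorem exists_polynomial_near_of_analytic {g : ℂ → ℂ} {r B : ℝ} (hr : 0 < r)
    (hg : AnalyticOnNhd ℂ g (Metric.closedBall 0 r))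
    (hB : ∀ z ∈ Metric.closedBall (0 : ℂ) r, ‖g z‖ ≤ B) {h : ℝ} (hh : 0 < h) (hhr : h < r)
    {u : ℝ → ℝ} (hu : ∀ t ∈ Icc 0 h, g t = (u t : ℂ)) (s : ℕ) :
    ∃ p : ℝ[X], p.degree < s ∧ ∀ x ∈ Icc (0 : ℝ) 1,
      |u (x * h) - p.eval x| ≤ B * (h / r) ^ s / (1 - h / r) := by
  have hB0 : 0 ≤ B := (norm_nonneg _).trans (hB 0 (by simp [hr.le]))
  let R : NNReal := ⟨r, hr.le⟩
  have hps : HasFPowerSeriesOnBall g (cauchyPowerSeries g 0 R) 0 R := by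
    refine DiffContOnCl.hasFPowerSeriesOnBall ?_ (by exact_mod_cast hr)
    refine ⟨hg.differentiableOn.mono Metric.ball_subset_closedBall, ?_⟩
    exact hg.continuousOn.mono Metric.closure_ball_subset_closedBall
  let a : ℕ → ℂ := (cauchyPowerSeries g 0 R).coeff
  -- Cauchy's estimates on the circle of radius `r`.
  have ha : ∀ k, ‖a k‖ ≤ B * (r⁻¹) ^ k := by
    intro k
    rw [← FormalMultilinearSeries.norm_apply_eq_norm_coef]
    refine (norm_cauchyPowerSeries_le g 0 R k).trans ?_
    rw [show (R : ℝ) = r from rfl, abs_of_pos hr]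
    gcongr
    have h2 : ∫ θ in (0 : ℝ)..2 * Real.pi, ‖g (circleMap 0 r θ)‖ ≤
        ∫ θ in (0 : ℝ)..2 * Real.pi, B := by
      refine intervalIntegral.integral_mono_on Real.two_pi_pos.le ?_ (by simp) fun θ _ =>
        hB _ (circleMap_mem_closedBall 0 hr.le θ)
      refine Continuous.intervalIntegrable (Continuous.norm ?_) _ _
      exact hg.continuousOn.comp_continuous (continuous_circleMap 0 r)
        fun θ => circleMap_mem_closedBall 0 hr.le θ
    rw [intervalIntegral.integral_const, sub_zero, smul_eq_mul] at h2
    rw [inv_mul_le_iff₀ Real.two_pi_pos]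
    exact h2
  have hlt : h / r < 1 := (div_lt_one hr).2 hhr
  -- The Taylor polynomial rescaled to `[0, 1]`. Real parts of the coefficients suffice because the
  -- function is real on `[0, h]`; the tail is geometric of ratio `h / r`.
  refine ⟨∑ k ∈ Finset.range s, C ((a k).re * h ^ k) * X ^ k, ?_, fun x hx => ?_⟩
  · refine (degree_lt_iff_coeff_zero _ _).2 fun n hn => ?_
    simp only [finsetSum_coeff, coeff_C_mul_X_pow]
    refine Finset.sum_eq_zero fun k hk => if_neg ?_
    have := Finset.mem_range.1 hk; omega
  · have hxh : x * h ∈ Icc 0 h := ⟨mul_nonneg hx.1 hh.le, by nlinarith [hx.2]⟩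
    have hsum : HasSum (fun k => ((x * h : ℝ) : ℂ) ^ k * a k) (g ((x * h : ℝ) : ℂ)) := by
      have := hps.hasSum (y := ((x * h : ℝ) : ℂ)) (by
        rw [Metric.mem_eball, edist_zero_right, ← ofReal_norm, Complex.norm_real,
          Real.norm_of_nonneg hxh.1, ← ENNReal.ofReal_coe_nnreal, show (R : ℝ) = r from rfl,
          ENNReal.ofReal_lt_ofReal_iff hr]
        exact hxh.2.trans_lt hhr)
      simpa [a] using this
    have hre : HasSum (fun k => (x * h) ^ k * (a k).re) (u (x * h)) := by
      rw [hu _ hxh] at hsum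
      have h1 := Complex.hasSum_re hsum
      simp only [← Complex.ofReal_pow, Complex.re_ofReal_mul, Complex.ofReal_re] at h1
      exact h1
    have hb : ∀ k, ‖(x * h) ^ k * (a k).re‖ ≤ B * (h / r) ^ k := by
      intro k
      rw [norm_mul, norm_pow, Real.norm_of_nonneg hxh.1]
      calc _ ≤ h ^ k * (B * r⁻¹ ^ k) := by
            gcongr
            · exact hxh.1
            · exact hxh.2
            · exact (Complex.abs_re_le_norm _).trans (ha k)
        _ = _ := by rw [div_eq_mul_inv, mul_pow]; ring
    have := norm_sub_le_of_geometric_bound_of_hasSum hlt hb hre s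
    rw [abs_sub_comm]
    convert this using 2
    rw [eval_finsetSum]
    refine congrArg (fun z => |z - u (x * h)|) ?_
    refine Finset.sum_congr rfl fun k _ => ?_
    simp
    ring

theorem exists_lipschitz_of_analyticOnNhd {m : ℕ} {f : (Fin m → ℝ) → (Fin m → ℝ)}
    {D K : Set (Fin m → ℝ)} (hf : AnalyticOnNhd ℝ f D) (hK : IsCompact K) (hKD : K ⊆ D) :
    ∃ L : ℝ, 0 < L ∧ ∀ x ∈ K, ∀ y ∈ K, ‖f x - f y‖ ≤ L * ‖x - y‖ := by
  have h : LocallyLipschitzOn K f := fun x hx => by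
    obtain ⟨C, t, ht, hC⟩ := ((hf x (hKD hx)).contDiffAt (n := 1)).exists_lipschitzOnWith
    exact ⟨C, t, mem_nhdsWithin_of_mem_nhds ht, hC⟩
  obtain ⟨C, hC⟩ := h.exists_lipschitzOnWith_of_compact hK
  -- Adding one makes the constant strictly positive, so that Gronwall's formula can divide by it.
  refine ⟨C + 1, by positivity, fun x hx y hy => ?_⟩
  have := hC.norm_sub_le hx hy
  nlinarith [norm_nonneg (x - y)]

/-- Gronwall's inequality for an integral equation with a small inhomogeneity. -/
theorem norm_le_of_integral_equation {E : Type*} [NormedAddCommGroup E] [NormedSpace ℝ E]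
    [CompleteSpace E] {e ε Δ : ℝ → E} {h L η b : ℝ} (hh : 0 < h) (hL : 0 < L)
    (hΔ : ContinuousOn Δ (Icc 0 b))
    (heq : ∀ c ∈ Icc 0 b, e c = h • ε c + h • ∫ x in (0 : ℝ)..c, Δ x)
    (hε : ∀ c ∈ Icc 0 b, ‖ε c‖ ≤ η) (hLip : ∀ c ∈ Icc 0 b, ‖Δ c‖ ≤ L * ‖e c‖) :
    ∀ c ∈ Icc 0 b, ‖e c‖ ≤ h * η * Real.exp (h * L * c) := by
  intro c hc
  have hb : 0 ≤ b := hc.1.trans hc.2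
  -- Gronwall is applied to the integral part alone: `ε` is merely bounded, so `e` need not be
  -- differentiable.
  let w : ℝ → E := fun c => h • ∫ x in (0 : ℝ)..c, Δ x
  have hi : IntegrableOn Δ (uIcc 0 b) := by
    rw [uIcc_of_le hb]; exact hΔ.integrableOn_Icc
  have hwc : ContinuousOn w (Icc 0 b) := by
    have := intervalIntegral.continuousOn_primitive_interval hi
    rw [uIcc_of_le hb] at this
    exact this.const_smul h
  have hwd : ∀ x ∈ Ico 0 b, HasDerivWithinAt w (h • Δ x) (Ici x) x := by
    intro x hx
    refine HasDerivWithinAt.const_smul h ?_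
    have hnhds : Icc 0 b ∈ 𝓝[>] x := mem_of_superset (Ioc_mem_nhdsGT hx.2)
      (fun z hz => ⟨hx.1.trans hz.1.le, hz.2⟩)
    refine intervalIntegral.integral_hasDerivWithinAt_right
      ((hΔ.mono ?_).intervalIntegrable) (t := Ioi x) ?_ ?_
    · rw [uIcc_of_le hx.1]; exact Icc_subset_Icc_right hx.2.le
    · exact ⟨Icc 0 b, hnhds, hΔ.aestronglyMeasurable measurableSet_Icc⟩
    · exact (hΔ x (Ico_subset_Icc_self hx)).mono_of_mem_nhdsWithin hnhds
  have hbound : ∀ x ∈ Ico 0 b, ‖h • Δ x‖ ≤ (h * L) * ‖w x‖ + (h * L) * (h * η) := by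
    intro x hx
    have hx' := Ico_subset_Icc_self hx
    have h1 : ‖e x‖ ≤ h * η + ‖w x‖ := by
      rw [heq x hx']
      refine (norm_add_le _ _).trans ?_
      rw [norm_smul, Real.norm_of_nonneg hh.le]
      gcongr
      exact hε x hx'
    rw [norm_smul, Real.norm_of_nonneg hh.le]
    calc h * ‖Δ x‖ ≤ h * (L * (h * η + ‖w x‖)) := by
          gcongr; exact (hLip x hx').trans (by gcongr)
      _ = _ := by ring
  have hg := norm_le_gronwallBound_of_norm_deriv_right_le (δ := 0) hwc hwd (by simp [w]) hbound c hc
  rw [gronwallBound_of_K_ne_0 (by positivity)] at hg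
  have hhL : h * L ≠ 0 := by positivity
  rw [heq c hc]
  refine (norm_add_le _ _).trans ?_
  rw [norm_smul, Real.norm_of_nonneg hh.le]
  have := mul_le_mul_of_nonneg_left (hε c hc) hh.le
  have h3 : h * L * (h * η) / (h * L) = h * η := by field_simp
  simp only [sub_zero, zero_mul, zero_add, h3] at hg
  linarith

/-! ### Vector-valued truncation and the integral equations -/

variable {m : ℕ}

theorem norm_vecTruncError_le {F : ℝ → Fin m → ℝ} (hF : ContinuousOn F (Icc 0 1)) {A : ℝ}
    (hA : ∀ x ∈ Icc (0 : ℝ) 1, ‖F x‖ ≤ A) (s : ℕ) {c : ℝ} (hc : c ∈ Icc (0 : ℝ) 1) :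
    ‖vecTruncError s F c‖ ≤ Real.sqrt (kernelDistSq s c) * A := by
  have hA0 : 0 ≤ A := (norm_nonneg _).trans (hA 0 (by simp))
  refine (pi_norm_le_iff_of_nonneg (by positivity)).2 fun i => ?_
  exact abs_truncError_le (continuousOn_pi.1 hF i)
    (fun x hx => (norm_le_pi_norm (F x) i).trans (hA x hx)) s hc

theorem vecTruncError_sub {F G : ℝ → Fin m → ℝ} (hF : ContinuousOn F (Icc 0 1))
    (hG : ContinuousOn G (Icc 0 1)) (s : ℕ) {c : ℝ} (hc : c ∈ Icc (0 : ℝ) 1) :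
    vecTruncError s (fun x => F x - G x) c = vecTruncError s F c - vecTruncError s G c :=
  funext fun i => truncError_sub (continuousOn_pi.1 hF i) (continuousOn_pi.1 hG i) s hc

theorem norm_vecTruncError_le_of_analytic {u : ℝ → Fin m → ℝ} {g : ℂ → Fin m → ℂ} {r B h : ℝ}
    (hh : 0 < h) (hhr : h < r) (hg : IsAnalyticExtension u h r g)
    (hB : ∀ z ∈ Metric.closedBall (0 : ℂ) r, ‖g z‖ ≤ B)
    (hu : ContinuousOn (fun x => u (x * h)) (Icc 0 1)) (s : ℕ) {c : ℝ} (hc : c ∈ Icc (0 : ℝ) 1) :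
    ‖vecTruncError s (fun x => u (x * h)) c‖ ≤ Real.pi * (B * (h / r) ^ s / (1 - h / r)) := by
  have hr : 0 < r := hh.trans hhr
  have hB0 : 0 ≤ B := (norm_nonneg _).trans (hB 0 (by simp [hr.le]))
  have hlt : 0 < 1 - h / r := sub_pos.2 ((div_lt_one hr).2 hhr)
  refine (pi_norm_le_iff_of_nonneg (by positivity)).2 fun i => ?_
  obtain ⟨p, hp, hpb⟩ := exists_polynomial_near_of_analytic hr
    (fun z hz => analyticAt_pi_iff.1 (hg.1 z hz) i)
    (fun z hz => (norm_le_pi_norm (g z) i).trans (hB z hz)) hh hhr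
    (fun t ht => hg.2 t ht i) s
  exact abs_truncError_le_of_near (continuousOn_pi.1 hu i) hp hpb hc

theorem scale_mem {c h T : ℝ} (hc : c ∈ Icc (0 : ℝ) 1) (hh : h ∈ Ioc 0 T) : c * h ∈ Icc 0 T :=
  ⟨mul_nonneg hc.1 hh.1.le, by nlinarith [hc.2, hc.1, hh.1, hh.2]⟩

variable {f : (Fin m → ℝ) → (Fin m → ℝ)} {D : Set (Fin m → ℝ)} {y₀ : Fin m → ℝ}

theorem IsApprox.continuousOn {h : ℝ} {s : ℕ} {σ : ℝ → Fin m → ℝ} (hσ : IsApprox f D y₀ h s σ) :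
    ContinuousOn (fun x => σ (x * h)) (Icc 0 1) := by
  refine ContinuousOn.congr (Continuous.continuousOn ?_) fun c hc => (hσ c hc).2
  refine continuous_const.add (Continuous.const_smul (continuous_finsetSum _ fun j _ => ?_) h)
  exact (intervalIntegral.continuous_primitive
    (fun a b => (continuous_basis j).intervalIntegrable a b) 0).smul continuous_const

theorem fourierCoeff_apply {h : ℝ} {u : ℝ → Fin m → ℝ}
    (hu : ContinuousOn (fun x => f (u (x * h))) (Icc 0 1)) (j : ℕ) (i : Fin m) :
    fourierCoeff f h u j i = ∫ x in (0 : ℝ)..1, weight x * basis j x * f (u (x * h)) i := by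
  have hint : IntervalIntegrable (fun x => (weight x * basis j x) • f (u (x * h))) volume 0 1 := by
    have h1 : IntervalIntegrable (fun x => weight x * basis j x) volume 0 1 :=
      intervalIntegrable_weight_mul (continuous_basis j).continuousOn
    exact h1.smul_continuousOn (by rwa [uIcc_of_le zero_le_one])
  have := (ContinuousLinearMap.proj (R := ℝ) (φ := fun _ : Fin m => ℝ) i).intervalIntegral_comp_comm
    hint
  simpa [fourierCoeff] using this.symm

/-- The truncated expansion of `f ∘ σ` is `f ∘ σ` plus its truncation defect, so the scheme is a
perturbed integral equation. -/
theorem IsApprox.sub_eq {h : ℝ} {s : ℕ} {σ : ℝ → Fin m → ℝ} (hσ : IsApprox f D y₀ h s σ)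
    (hf : ContinuousOn f D) {c : ℝ} (hc : c ∈ Icc (0 : ℝ) 1) :
    σ (c * h) - y₀ = h • vecTruncError s (fun x => f (σ (x * h))) c +
      h • ∫ x in (0 : ℝ)..c, f (σ (x * h)) := by
  have hF : ContinuousOn (fun x => f (σ (x * h))) (Icc 0 1) :=
    hf.comp hσ.continuousOn fun x hx => (hσ x hx).1
  rw [(hσ c hc).2, add_sub_cancel_left, ← smul_add]
  congr 1
  have hint : IntervalIntegrable (fun x => f (σ (x * h))) volume 0 c :=
    (hF.mono (by rw [uIcc_of_le hc.1]; exact Icc_subset_Icc_right hc.2)).intervalIntegrable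
  ext i
  have := (ContinuousLinearMap.proj (R := ℝ) (φ := fun _ : Fin m => ℝ) i).intervalIntegral_comp_comm
    hint
  simp only [ContinuousLinearMap.proj_apply] at this
  simp only [Pi.add_apply, Finset.sum_apply, Pi.smul_apply, smul_eq_mul, vecTruncError, truncError,
    fourierCoeff_apply hF, ← this]
  ring

theorem IsSolution.continuousOn {T : ℝ} {y : ℝ → Fin m → ℝ} (hy : IsSolution f D y₀ T y) :
    ContinuousOn y (Icc 0 T) := fun t ht => ((hy.2 t ht).2).continuousWithinAt

theorem IsSolution.continuousOn_scale {T h : ℝ} {y : ℝ → Fin m → ℝ} (hy : IsSolution f D y₀ T y)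
    (hh : h ∈ Ioc 0 T) : ContinuousOn (fun x => y (x * h)) (Icc 0 1) :=
  hy.continuousOn.comp (by fun_prop) fun _ hx => scale_mem hx hh

theorem IsSolution.sub_eq {T h : ℝ} {y : ℝ → Fin m → ℝ} (hy : IsSolution f D y₀ T y)
    (hf : ContinuousOn f D) (hh : h ∈ Ioc 0 T) {c : ℝ} (hc : c ∈ Icc (0 : ℝ) 1) :
    y (c * h) - y₀ = h • ∫ x in (0 : ℝ)..c, f (y (x * h)) := by
  have hcT := scale_mem hc hh
  have hfy : ContinuousOn (fun t => f (y t)) (Icc 0 T) :=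
    hf.comp hy.continuousOn fun t ht => (hy.2 t ht).1
  have hd : ∀ t ∈ Ioo 0 (c * h), HasDerivWithinAt y (f (y t)) (Ioi t) t := fun t ht => by
    have htT : t ∈ Ico 0 T := ⟨ht.1.le, ht.2.trans_le hcT.2⟩
    refine (hy.2 t (Ico_subset_Icc_self htT)).2.mono_of_mem_nhdsWithin ?_
    exact mem_of_superset (Ioc_mem_nhdsGT htT.2) fun z hz => ⟨htT.1.trans hz.1.le, hz.2⟩
  have hi : IntervalIntegrable (fun t => f (y t)) volume 0 (c * h) := by
    refine (hfy.mono ?_).intervalIntegrable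
    rw [uIcc_of_le hcT.1]; exact Icc_subset_Icc_right hcT.2
  rw [intervalIntegral.smul_integral_comp_mul_right (f := fun t => f (y t)), zero_mul,
    integral_eq_sub_of_hasDeriv_right_of_le hcT.1
      (hy.continuousOn.mono (Icc_subset_Icc_right hcT.2)) hd hi, hy.1]

theorem error_eq {T h : ℝ} {s : ℕ} {y σ : ℝ → Fin m → ℝ} (hy : IsSolution f D y₀ T y)
    (hf : ContinuousOn f D) (hh : h ∈ Ioc 0 T) (hσ : IsApprox f D y₀ h s σ) {c : ℝ}
    (hc : c ∈ Icc (0 : ℝ) 1) :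
    σ (c * h) - y (c * h) = h • vecTruncError s (fun x => f (σ (x * h))) c +
      h • ∫ x in (0 : ℝ)..c, (f (σ (x * h)) - f (y (x * h))) := by
  have hi : ∀ {u : ℝ → Fin m → ℝ}, ContinuousOn u (Icc 0 1) → IntervalIntegrable u volume 0 c :=
    fun hu => (hu.mono (by rw [uIcc_of_le hc.1]; exact Icc_subset_Icc_right hc.2)).intervalIntegrable
  have hF : ContinuousOn (fun x => f (σ (x * h))) (Icc 0 1) :=
    hf.comp hσ.continuousOn fun x hx => (hσ x hx).1
  have hG : ContinuousOn (fun x => f (y (x * h))) (Icc 0 1) :=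
    hf.comp (hy.continuousOn_scale hh) fun x hx => (hy.2 _ (scale_mem hx hh)).1
  rw [intervalIntegral.integral_sub (hi hF) (hi hG),
    smul_sub, ← hy.sub_eq hf hh hc, ← sub_sub_sub_cancel_right _ _ y₀, hσ.sub_eq hf hc]
  abel

/-- Gronwall's bound for the error as long as the Lipschitz condition holds along both curves. -/
theorem norm_error_le {T h L η b : ℝ} {s : ℕ} {y σ : ℝ → Fin m → ℝ}
    (hy : IsSolution f D y₀ T y) (hf : ContinuousOn f D) (hh : h ∈ Ioc 0 T) (hL : 0 < L)
    (hσ : IsApprox f D y₀ h s σ) (hb : b ≤ 1)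
    (hη : ∀ c ∈ Icc 0 b, ‖vecTruncError s (fun x => f (σ (x * h))) c‖ ≤ η)
    (hLip : ∀ c ∈ Icc 0 b, ‖f (σ (c * h)) - f (y (c * h))‖ ≤ L * ‖σ (c * h) - y (c * h)‖)
    {c : ℝ} (hc : c ∈ Icc 0 b) :
    ‖σ (c * h) - y (c * h)‖ ≤ h * η * Real.exp (T * L) := by
  have hsub : Icc 0 b ⊆ Icc (0 : ℝ) 1 := Icc_subset_Icc_right hb
  have hη0 : 0 ≤ η := (norm_nonneg _).trans (hη c hc)
  have hΔ : ContinuousOn (fun x => f (σ (x * h)) - f (y (x * h))) (Icc 0 b) :=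
    ((hf.comp hσ.continuousOn fun x hx => (hσ x hx).1).sub
      (hf.comp (hy.continuousOn_scale hh) fun x hx => (hy.2 _ (scale_mem hx hh)).1)).mono hsub
  refine (norm_le_of_integral_equation (e := fun c => σ (c * h) - y (c * h)) hh.1 hL hΔ
    (fun c hc => error_eq hy hf hh hσ (hsub hc)) hη hLip c hc).trans ?_
  have h0 := hh.1
  have h1 : h * L * c ≤ T * L := by
    have : h * c ≤ T := by rw [mul_comm]; exact (scale_mem (hsub hc) hh).2
    nlinarith
  gcongr

/-! ### Error bounds -/

theorem exists_seminorm_le (N : Seminorm ℝ (Fin m → ℝ)) :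
    ∃ C : ℝ, 0 < C ∧ ∀ x, N x ≤ C * ‖x‖ := by
  have hN : Continuous N := continuousOn_univ.1 (N.convexOn.continuousOn isOpen_univ)
  exact N.bound_of_continuous_normedSpace hN

theorem truncation_bound_mono {A B r T h : ℝ} {s : ℕ} (hA : 0 ≤ A) (hAB : A ≤ B)
    (hh : h ∈ Ioc 0 T) (hT : T < r) :
    Real.pi * (A * (h / r) ^ s / (1 - h / r)) ≤ Real.pi * B / (1 - T / r) * (h / r) ^ s := by
  have h0 := hh.1
  have hr : 0 < r := hh.1.trans_le (hh.2.trans hT.le)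
  have h1 : h / r ≤ T / r := by gcongr; exact hh.2
  have h2 : 0 < 1 - T / r := sub_pos.2 ((div_lt_one hr).2 hT)
  have hB : 0 ≤ B := hA.trans hAB
  calc Real.pi * (A * (h / r) ^ s / (1 - h / r))
      ≤ Real.pi * (B * (h / r) ^ s / (1 - T / r)) := by gcongr
    _ = _ := by ring

/-- The error bound when the truncation operator is contractive enough. -/
theorem norm_error_le_of_small {T h L q A r : ℝ} {s : ℕ} {y σ : ℝ → Fin m → ℝ} {g : ℂ → Fin m → ℂ}
    (hy : IsSolution f D y₀ T y) (hf : ContinuousOn f D) (hh : h ∈ Ioc 0 T) (hT : T < r)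
    (hL : 0 < L) (hσ : IsApprox f D y₀ h s σ)
    (hg : IsAnalyticExtension (fun t => f (y t)) T r g)
    (hA : ∀ z ∈ Metric.closedBall (0 : ℂ) r, ‖g z‖ ≤ A)
    (hLip : ∀ c ∈ Icc (0 : ℝ) 1, ‖f (σ (c * h)) - f (y (c * h))‖ ≤ L * ‖σ (c * h) - y (c * h)‖)
    (hq : ∀ c ∈ Icc (0 : ℝ) 1, Real.sqrt (kernelDistSq s c) ≤ q)
    (hsmall : h * Real.exp (T * L) * (q * L) ≤ 1 / 2) {c : ℝ} (hc : c ∈ Icc (0 : ℝ) 1) :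
    ‖σ (c * h) - y (c * h)‖ ≤
      h * (2 * Real.exp (T * L) * (Real.pi * A / (1 - T / r))) * (h / r) ^ s := by
  have hF : ContinuousOn (fun x => f (σ (x * h))) (Icc 0 1) :=
    hf.comp hσ.continuousOn fun x hx => (hσ x hx).1
  have hG : ContinuousOn (fun x => f (y (x * h))) (Icc 0 1) :=
    hf.comp (hy.continuousOn_scale hh) fun x hx => (hy.2 _ (scale_mem hx hh)).1
  have hA0 : 0 ≤ A := (norm_nonneg _).trans (hA 0 (by simp [(hh.1.trans_le hh.2).le.trans hT.le]))
  obtain ⟨c₁, hc₁, hmax⟩ := isCompact_Icc.exists_isMaxOn (nonempty_Icc.2 zero_le_one)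
    (hσ.continuousOn.sub (hy.continuousOn_scale hh)).norm
  have hmax' : ∀ c ∈ Icc (0 : ℝ) 1, ‖σ (c * h) - y (c * h)‖ ≤ ‖σ (c₁ * h) - y (c₁ * h)‖ :=
    fun c hc => hmax hc
  set X := ‖σ (c₁ * h) - y (c₁ * h)‖
  have hX : 0 ≤ X := norm_nonneg _
  set ρ := Real.pi * A / (1 - T / r) * (h / r) ^ s with hρ
  have hq0 : 0 ≤ q := (Real.sqrt_nonneg _).trans (hq c hc)
  -- Split `f ∘ σ` into `f ∘ y`, whose analyticity gives `ρ`, and the difference, controlled by the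
  -- maximal error `X`.
  have hη : ∀ c ∈ Icc (0 : ℝ) 1, ‖vecTruncError s (fun x => f (σ (x * h))) c‖ ≤ q * (L * X) + ρ := by
    intro c hc
    have h1 := vecTruncError_sub hF hG s hc
    rw [eq_sub_iff_add_eq] at h1
    rw [← h1]
    refine (norm_add_le _ _).trans (add_le_add ?_ ?_)
    · refine (norm_vecTruncError_le (hF.sub hG) (A := L * X) (fun x hx => ?_) s hc).trans ?_
      · exact (hLip x hx).trans (by gcongr; exact hmax' x hx)
      · gcongr; exact hq c hc
    · have hext : IsAnalyticExtension (fun t => f (y t)) h r g :=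
        ⟨hg.1, fun t ht => hg.2 t ⟨ht.1, ht.2.trans hh.2⟩⟩
      exact (norm_vecTruncError_le_of_analytic hh.1 (hh.2.trans_lt hT) hext hA hG s hc).trans
        (truncation_bound_mono hA0 le_rfl hh hT)
  have h2 : X ≤ h * (q * (L * X) + ρ) * Real.exp (T * L) :=
    norm_error_le hy hf hh hL hσ le_rfl hη hLip hc₁
  -- Smallness lets half of `X` be absorbed into the left side.
  have h3 : h * Real.exp (T * L) * (q * L) * X ≤ 1 / 2 * X := by gcongr
  have h4 : X ≤ 2 * (h * ρ * Real.exp (T * L)) := by nlinarith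
  refine (hmax' c hc).trans (h4.trans (le_of_eq ?_))
  rw [hρ]; ring

/-- Absorption works for large `s`, where the kernel distance is small, and for small `h`, where the
bound `π` is enough. Otherwise `h` is bounded below and `s` above, so `h (h / r) ^ s` stays away
from zero and boundedness of `σ` and `y` suffices. -/
theorem exists_error_bound_of_analytic_solution {T r : ℝ} {y : ℝ → Fin m → ℝ}
    {K : Set (Fin m → ℝ)} {g : ℂ → Fin m → ℂ} (hT0 : 0 < T) (hT : T < r)
    (hf : AnalyticOnNhd ℝ f D) (hy : IsSolution f D y₀ T y)
    (hg : IsAnalyticExtension (fun t => f (y t)) T r g) (hK : IsCompact K) (hKD : K ⊆ D) :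
    ∃ M : ℝ, 0 < M ∧ ∀ h ∈ Ioc 0 T, ∀ s : ℕ, ∀ σ : ℝ → Fin m → ℝ, IsApprox f D y₀ h s σ →
      (∀ c ∈ Icc (0 : ℝ) 1, σ (c * h) ∈ K) → ∀ c ∈ Icc (0 : ℝ) 1,
        ‖σ (c * h) - y (c * h)‖ ≤ h * M * (h / r) ^ s := by
  have hr : 0 < r := hT0.trans hT
  have hK' : IsCompact (K ∪ y '' Icc 0 T) := hK.union (isCompact_Icc.image_of_continuousOn
    hy.continuousOn)
  have hKD' : K ∪ y '' Icc 0 T ⊆ D := union_subset hKD (by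
    rintro _ ⟨t, ht, rfl⟩; exact (hy.2 t ht).1)
  obtain ⟨L, hL, hLip⟩ := exists_lipschitz_of_analyticOnNhd hf hK' hKD'
  obtain ⟨A, hA⟩ := (isCompact_closedBall (0 : ℂ) r).exists_bound_of_continuousOn hg.1.continuousOn
  obtain ⟨d, hd⟩ := hK'.isBounded.exists_norm_le
  have hA0 : 0 ≤ A := (norm_nonneg _).trans (hA 0 (by simp [hr.le]))
  have hd0 : 0 ≤ d := (norm_nonneg _).trans
    (hd (y 0) (Or.inr (mem_image_of_mem y ⟨le_rfl, hT0.le⟩)))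
  set E := Real.exp (T * L) with hE
  have hE0 : 0 < E := Real.exp_pos _
  -- This tolerance and `h₀` below are chosen so that the absorption factor is at most `1 / 2`, for
  -- `h ≤ T` and `h ≤ h₀` respectively.
  obtain ⟨s₀, hs₀⟩ := exists_forall_sqrt_kernelDistSq_le (ε := 1 / (2 * T * E * L)) (by positivity)
  set h₀ := 1 / (2 * E * (Real.pi * L)) with hh₀
  have hh₀0 : 0 < h₀ := by positivity
  set M₁ := 2 * E * (Real.pi * A / (1 - T / r)) with hM₁
  have hM₁0 : 0 ≤ M₁ := by
    have : 0 < 1 - T / r := sub_pos.2 ((div_lt_one hr).2 hT)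
    positivity
  set M₂ := 2 * d / (h₀ * (h₀ / r) ^ s₀) with hM₂
  have hM₂0 : 0 ≤ M₂ := by positivity
  refine ⟨M₁ + M₂ + 1, by positivity, fun h hh s σ hσ hσK c hc => ?_⟩
  have h0 := hh.1
  have hmemσ : ∀ c ∈ Icc (0 : ℝ) 1, σ (c * h) ∈ K ∪ y '' Icc 0 T := fun c hc => Or.inl (hσK c hc)
  have hmemy : ∀ c ∈ Icc (0 : ℝ) 1, y (c * h) ∈ K ∪ y '' Icc 0 T :=
    fun c hc => Or.inr (mem_image_of_mem y (scale_mem hc hh))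
  have hsmall : ∀ q, (∀ c ∈ Icc (0 : ℝ) 1, Real.sqrt (kernelDistSq s c) ≤ q) →
      h * E * (q * L) ≤ 1 / 2 →
      ‖σ (c * h) - y (c * h)‖ ≤ h * (M₁ + M₂ + 1) * (h / r) ^ s := by
    intro q hq hqs
    refine (norm_error_le_of_small hy hf.continuousOn hh hT hL hσ hg hA
      (fun c hc => hLip _ (hmemσ c hc) _ (hmemy c hc)) hq hqs hc).trans ?_
    gcongr
    linarith
  by_cases hs : s₀ ≤ s
  · refine hsmall _ (hs₀ s hs) ?_
    calc h * E * (1 / (2 * T * E * L) * L) ≤ T * E * (1 / (2 * T * E * L) * L) := by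
          gcongr; exact hh.2
      _ = 1 / 2 := by field_simp
  by_cases hhs : h ≤ h₀
  · refine hsmall _ (fun c hc => sqrt_kernelDistSq_le s hc) ?_
    calc h * E * (Real.pi * L) ≤ h₀ * E * (Real.pi * L) := by gcongr
      _ = 1 / 2 := by rw [hh₀]; field_simp
  push Not at hs hhs
  have h1 : ‖σ (c * h) - y (c * h)‖ ≤ 2 * d := by
    refine (norm_sub_le _ _).trans ?_
    linarith [hd _ (hmemσ c hc), hd _ (hmemy c hc)]
  have h2 : (h₀ / r) ^ s₀ ≤ (h / r) ^ s := by
    calc (h₀ / r) ^ s₀ ≤ (h / r) ^ s₀ := by gcongr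
      _ ≤ (h / r) ^ s := pow_le_pow_of_le_one (by positivity)
        ((div_le_one hr).2 (hh.2.trans hT.le)) hs.le
  have h3 : 2 * d = M₂ * (h₀ * (h₀ / r) ^ s₀) := by rw [hM₂]; field_simp
  calc _ ≤ M₂ * (h₀ * (h₀ / r) ^ s₀) := h1.trans h3.le
    _ ≤ (M₁ + M₂ + 1) * (h * (h / r) ^ s) := by gcongr; linarith
    _ = _ := by ring

/-- No compact set containing `σ` is given, so the Lipschitz constant comes from a closed
`δ`-neighbourhood of the solution curve. If Gronwall's bound is below `δ`, the approximation cannot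
leave it; if not, that bound divided by `δ` is at least one and an a priori estimate suffices. -/
theorem exists_error_bound_of_analytic_approx {T r : ℝ} {y : ℝ → Fin m → ℝ} (hT0 : 0 < T)
    (hT : T < r) (hD : IsOpen D) (hf : AnalyticOnNhd ℝ f D) (hy : IsSolution f D y₀ T y) (B : ℝ) :
    ∃ M : ℝ, 0 < M ∧ ∀ h ∈ Ioc 0 T, ∀ s : ℕ, ∀ σ : ℝ → Fin m → ℝ, IsApprox f D y₀ h s σ →
      (∃ g : ℂ → Fin m → ℂ, IsAnalyticExtension (fun t => f (σ t)) h r g ∧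
        ∀ z ∈ Metric.closedBall (0 : ℂ) r, ‖g z‖ ≤ B) → ∀ c ∈ Icc (0 : ℝ) 1,
        ‖σ (c * h) - y (c * h)‖ ≤ h * M * (h / r) ^ s := by
  have hr : 0 < r := hT0.trans hT
  have hyc : IsCompact (y '' Icc 0 T) := isCompact_Icc.image_of_continuousOn hy.continuousOn
  obtain ⟨δ, hδ, hδD⟩ := hyc.exists_cthickening_subset_open hD (by
    rintro _ ⟨t, ht, rfl⟩; exact (hy.2 t ht).1)
  obtain ⟨L, hL, hLip⟩ := exists_lipschitz_of_analyticOnNhd hf hyc.cthickening hδD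
  obtain ⟨d, hd⟩ := hyc.isBounded.exists_norm_le
  have hd0 : 0 ≤ d := (norm_nonneg _).trans (hd (y 0) (mem_image_of_mem y ⟨le_rfl, hT0.le⟩))
  set E := Real.exp (T * L) with hE
  have hE0 : 0 < E := Real.exp_pos _
  set B' := max B 1 with hB'
  have hB'0 : 0 < B' := lt_of_lt_of_le one_pos (le_max_right _ _)
  set C₁ := Real.pi * B' / (1 - T / r) with hC₁
  have hC₁0 : 0 < C₁ := by
    have : 0 < 1 - T / r := sub_pos.2 ((div_lt_one hr).2 hT)
    positivity
  -- The a priori error bound: the first two terms bound `‖σ - y₀‖`, the last `‖y₀ - y‖`.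
  set d' := T * (Real.pi * B') + T * B' + (‖y₀‖ + d) with hd'
  have hd'0 : 0 ≤ d' := by positivity
  refine ⟨C₁ * E + d' * (C₁ * E) / δ, by positivity, fun h hh s σ hσ ⟨g, hg, hgB⟩ c hc => ?_⟩
  have h0 := hh.1
  have hB0 : 0 ≤ B := (norm_nonneg _).trans (hgB 0 (by simp [hr.le]))
  have hF : ContinuousOn (fun x => f (σ (x * h))) (Icc 0 1) :=
    hf.continuousOn.comp hσ.continuousOn fun x hx => (hσ x hx).1
  have hη : ∀ c ∈ Icc (0 : ℝ) 1,
      ‖vecTruncError s (fun x => f (σ (x * h))) c‖ ≤ C₁ * (h / r) ^ s := fun c hc =>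
    (norm_vecTruncError_le_of_analytic (u := fun t => f (σ t)) hh.1 (hh.2.trans_lt hT) hg hgB hF s
      hc).trans (truncation_bound_mono hB0 (le_max_left _ _) hh hT)
  by_cases hsmall : h * (C₁ * (h / r) ^ s) * E < δ
  · have hcont : ContinuousOn (fun c => ‖σ (c * h) - y (c * h)‖) (Icc 0 1) :=
      (hσ.continuousOn.sub (hy.continuousOn_scale hh)).norm
    have hgron : ∀ b ∈ Icc (0 : ℝ) 1, (∀ c ∈ Icc 0 b, ‖σ (c * h) - y (c * h)‖ ≤ δ) →
        ∀ c ∈ Icc 0 b, ‖σ (c * h) - y (c * h)‖ ≤ h * (C₁ * (h / r) ^ s) * E := by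
      intro b hb hbδ c hc
      have hsub : Icc 0 b ⊆ Icc (0 : ℝ) 1 := Icc_subset_Icc_right hb.2
      refine norm_error_le hy hf.continuousOn hh hL hσ hb.2 (fun c hc => hη c (hsub hc))
        (fun c hc => ?_) hc
      have hyt : y (c * h) ∈ y '' Icc 0 T := mem_image_of_mem y (scale_mem (hsub hc) hh)
      refine hLip _ (Metric.mem_cthickening_of_dist_le _ _ _ _ hyt ?_) _
        (Metric.self_subset_cthickening _ hyt)
      rw [dist_eq_norm]; exact hbδ c hc
    -- At the first point `a` where the error equals `δ`, Gronwall on `[0, a]` makes it strictly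
    -- smaller than `δ`.
    have hstay : ∀ c ∈ Icc (0 : ℝ) 1, ‖σ (c * h) - y (c * h)‖ ≤ δ := by
      have hzero : ‖σ (0 * h) - y (0 * h)‖ ≤ δ := by
        rw [error_eq hy hf.continuousOn hh hσ ⟨le_rfl, zero_le_one⟩]
        have hv : vecTruncError s (fun x => f (σ (x * h))) 0 = 0 := by
          funext i; simp [vecTruncError, truncError]
        simp [hv, hδ.le]
      have hivt : ∀ c ∈ Icc (0 : ℝ) 1, δ < ‖σ (c * h) - y (c * h)‖ →
          ∃ c' ∈ Icc 0 c, ‖σ (c' * h) - y (c' * h)‖ = δ := fun c hc hlt =>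
        intermediate_value_Icc hc.1 (hcont.mono (Icc_subset_Icc_right hc.2)) ⟨hzero, hlt.le⟩
      by_contra! hne
      obtain ⟨c₀, hc₀, hlt⟩ := hne
      obtain ⟨c₁, hc₁, hc₁δ⟩ := hivt c₀ hc₀ hlt
      have hcpt : IsCompact (Icc (0 : ℝ) 1 ∩ (fun c => ‖σ (c * h) - y (c * h)‖) ⁻¹' {δ}) :=
        isCompact_Icc.of_isClosed_subset
          (hcont.preimage_isClosed_of_isClosed isClosed_Icc isClosed_singleton) inter_subset_left
      obtain ⟨a, ⟨ha, haδ⟩, hamin⟩ :=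
        hcpt.exists_isLeast ⟨c₁, ⟨hc₁.1, hc₁.2.trans hc₀.2⟩, hc₁δ⟩
      have hbefore : ∀ c ∈ Icc 0 a, ‖σ (c * h) - y (c * h)‖ ≤ δ := by
        intro c hc
        by_contra! hlt'
        obtain ⟨c', hc', hc'δ⟩ := hivt c ⟨hc.1, hc.2.trans ha.2⟩ hlt'
        have h1 : a ≤ c' := hamin ⟨⟨hc'.1, hc'.2.trans (hc.2.trans ha.2)⟩, hc'δ⟩
        have h2 : c' = c := le_antisymm hc'.2 (hc.2.trans h1)
        rw [h2] at hc'δ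
        exact hlt'.ne' hc'δ
      exact absurd haδ (((hgron a ha hbefore a ⟨ha.1, le_rfl⟩).trans_lt hsmall).ne)
    refine (hgron 1 ⟨zero_le_one, le_rfl⟩ hstay c hc).trans ?_
    have : 0 ≤ d' * (C₁ * E) / δ := by positivity
    calc h * (C₁ * (h / r) ^ s) * E = h * (C₁ * E) * (h / r) ^ s := by ring
      _ ≤ _ := by gcongr; linarith
  · push Not at hsmall
    have hFB : ∀ x ∈ Icc (0 : ℝ) 1, ‖f (σ (x * h))‖ ≤ B' := by
      intro x hx
      have hxh : x * h ∈ Icc 0 h := scale_mem hx ⟨hh.1, le_rfl⟩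
      refine (pi_norm_le_iff_of_nonneg hB'0.le).2 fun i => ?_
      have h1 := (norm_le_pi_norm (g ((x * h : ℝ) : ℂ)) i).trans (hgB _ (by
        rw [mem_closedBall_zero_iff, Complex.norm_real, Real.norm_of_nonneg hxh.1]
        exact hxh.2.trans (hh.2.trans hT.le)))
      rw [hg.2 _ hxh i, Complex.norm_real] at h1
      exact h1.trans (le_max_left _ _)
    have h1 : ‖σ (c * h) - y (c * h)‖ ≤ d' := by
      have e1 : ‖σ (c * h) - y₀‖ ≤ T * (Real.pi * B') + T * B' := by
        rw [hσ.sub_eq hf.continuousOn hc]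
        refine (norm_add_le _ _).trans (add_le_add ?_ ?_) <;>
          rw [norm_smul, Real.norm_of_nonneg h0.le]
        · gcongr
          · exact hh.2
          · refine (norm_vecTruncError_le hF hFB s hc).trans ?_
            gcongr
            exact sqrt_kernelDistSq_le s hc
        · gcongr
          · exact hh.2
          · refine (intervalIntegral.norm_integral_le_of_norm_le_const (C := B') fun x hx => ?_).trans
              ?_
            · rw [uIoc_of_le hc.1] at hx
              exact hFB x ⟨hx.1.le, hx.2.trans hc.2⟩
            · rw [sub_zero, abs_of_nonneg hc.1]
              nlinarith [hc.2]
      have e2 := hd _ (mem_image_of_mem y (scale_mem hc hh))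
      calc ‖σ (c * h) - y (c * h)‖ = ‖(σ (c * h) - y₀) + (y₀ - y (c * h))‖ := by
            congr 1; abel
        _ ≤ ‖σ (c * h) - y₀‖ + ‖y₀ - y (c * h)‖ := norm_add_le _ _
        _ ≤ _ := add_le_add e1 ((norm_sub_le _ _).trans (by gcongr))
    have h2 : 0 ≤ h * (C₁ * E) * (h / r) ^ s := by positivity
    calc ‖σ (c * h) - y (c * h)‖ ≤ d' * 1 := by simpa using h1
      _ ≤ d' * (h * (C₁ * (h / r) ^ s) * E / δ) := by
          gcongr; exact (one_le_div hδ).2 hsmall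
      _ = h * (d' * (C₁ * E) / δ) * (h / r) ^ s := by ring
      _ ≤ _ := by gcongr; nlinarith [mul_pos hC₁0 hE0]

end ChebyshevSpectral

theorem mainTheorem2 {m : ℕ}
    (f : (Fin m → ℝ) → (Fin m → ℝ)) (D : Set (Fin m → ℝ)) (hD : IsOpen D)
    (hf : AnalyticOnNhd ℝ f D)
    (rstar hstar : ℝ) (hstar_pos : 0 < hstar) (hstar_lt : hstar < rstar)
    (y₀ : Fin m → ℝ) (y : ℝ → Fin m → ℝ)
    (hy : ChebyshevSpectral.IsSolution f D y₀ hstar y)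
    (N : Seminorm ℝ (Fin m → ℝ)) :
    ((∃ g : ℂ → Fin m → ℂ,
        ChebyshevSpectral.IsAnalyticExtension (fun t => f (y t)) hstar rstar g) →
      ∀ K : Set (Fin m → ℝ), IsCompact K → K ⊆ D →
        ∃ M : ℝ, 0 < M ∧ ∀ h ∈ Set.Ioc 0 hstar, 1 < rstar / h ∧
          ∀ s : ℕ, 1 ≤ s → ∀ σ : ℝ → Fin m → ℝ,
            ChebyshevSpectral.IsApprox f D y₀ h s σ →
            (∀ c ∈ Set.Icc (0 : ℝ) 1, σ (c * h) ∈ K) →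
            ∀ c ∈ Set.Icc (0 : ℝ) 1,
              N (σ (c * h) - y (c * h)) ≤ h * M * (rstar / h) ^ (-(s : ℤ))) ∧
    (∀ B : ℝ,
        ∃ M : ℝ, 0 < M ∧ ∀ h ∈ Set.Ioc 0 hstar, 1 < rstar / h ∧
          ∀ s : ℕ, 1 ≤ s → ∀ σ : ℝ → Fin m → ℝ,
            ChebyshevSpectral.IsApprox f D y₀ h s σ →
            (∃ g : ℂ → Fin m → ℂ,
              ChebyshevSpectral.IsAnalyticExtension (fun t => f (σ t)) h rstar g ∧
              ∀ z ∈ Metric.closedBall (0 : ℂ) rstar, ‖g z‖ ≤ B) →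
            ∀ c ∈ Set.Icc (0 : ℝ) 1,
              N (σ (c * h) - y (c * h)) ≤ h * M * (rstar / h) ^ (-(s : ℤ))) := by
  obtain ⟨C, hC, hN⟩ := ChebyshevSpectral.exists_seminorm_le N
  have hratio : ∀ h ∈ Set.Ioc 0 hstar, 1 < rstar / h := fun h hh =>
    (one_lt_div hh.1).2 (hh.2.trans_lt hstar_lt)
  have hfinal : ∀ {M h : ℝ} {s : ℕ} {x : Fin m → ℝ}, ‖x‖ ≤ h * M * (h / rstar) ^ s →
      N x ≤ h * (C * M) * (rstar / h) ^ (-(s : ℤ)) := by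
    intro M h s x hx
    rw [zpow_neg, zpow_natCast, ← inv_pow, inv_div]
    calc N x ≤ C * (h * M * (h / rstar) ^ s) := (hN x).trans (by gcongr)
      _ = _ := by ring
  refine ⟨fun ⟨g, hg⟩ K hK hKD => ?_, fun B => ?_⟩
  · obtain ⟨M, hM, hb⟩ := ChebyshevSpectral.exists_error_bound_of_analytic_solution hstar_pos
      hstar_lt hf hy hg hK hKD
    exact ⟨C * M, mul_pos hC hM, fun h hh => ⟨hratio h hh, fun s _ σ hσ hσK c hc =>
      hfinal (hb h hh s σ hσ hσK c hc)⟩⟩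
  · obtain ⟨M, hM, hb⟩ := ChebyshevSpectral.exists_error_bound_of_analytic_approx hstar_pos
      hstar_lt hD hf hy B
    exact ⟨C * M, mul_pos hC hM, fun h hh => ⟨hratio h hh, fun s _ σ hσ hσg c hc =>
      hfinal (hb h hh s σ hσ hσg c hc)⟩⟩
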